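/- Let $M$ be a natural number and let $\{1,\dots,M\}$ be a state space. For each state $i$ let $\mathcal W_i$ and $\mathcal Z_i$ be nonempty sets of $M$-dimensional probability vectors and let $\emptyset\neq\mathcal D_i\subset\{0,1\}$; let $c_i:\mathcal W_i\to\mathbb R$, $k_i:\mathcal Z_i\to\mathbb R$, $\rho>0$ and $\delta>0$. Put $\mathcal P=\prod_{i=1}^M \mathcal W_i\times\mathcal Z_i\times\mathcal D_i$, and write a policy $P\in\mathcal P$ as $P=(w,z,\psi)$, with $w_i=(w_{ij})_j\in\mathcal W_i$, $z_i=(z_{ij})_j\in\mathcal Z_i$, $\psi_i\in\mathcal D_i$. Under $P$, $(X^n)_{n\ge0}$ is the homogeneous Markov chain with $$\mathbb P(X^{n+1}=j\mid X^n=i)=\begin{cases}w_{ij}&\text{if }\psi_i=0,\\ z_{ij}&\text{if }\psi_i=1.\end{cases}$$ Let $U(i,P)=c_i(w_i)$, $D(i,P)=1/(1+\rho)$ if $\psi_i=0$, and $U(i,P)=k_i(z_i)$, $D(i,P)=1$ if $\psi_i=1$. Let $[L(w)]_{ij}=w_{ij}/(1+\rho)$, $[B(z)]_{ij}=z_{ij}$,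 $[c(w)]_i=c_i(w_i)$, $[k(z)]_i=k_i(z_i)$, $\Psi=\operatorname{diag}(\psi)$, and $$A(P)=(I-\Psi)(I-L(w))+\delta\Psi(I-B(z)),\qquad b(P)=(I-\Psi)c(w)+\delta\Psi k(z).$$ The order on $\mathbb R^M$, and with it every supremum of vectors, is element-wise. Assume: * (H0) $P\mapsto A(P)^{-1}$ is bounded on $\{P\in\mathcal P: A(P)\text{ is nonsingular}\}$. * (H1) (i) $A$ and $b$ are bounded on $\mathcal P$; (ii) for every $x\in\mathbb R^M$ there is $P_x\in\mathcal P$ with $-A(P_x)x+b(P_x)=\sup_{P\in\mathcal P}\{-A(P)x+b(P)\}$. * (H2) For each $P=(w,z,\psi)\in\mathcal P$ and each state $i$ with $\psi_i=1$ there is a path from $i$ to some state $j$ with $\psi_j=0$ in the directed graph of $B(z)$, which has an edge from $r$ to $s$ if and only if $z_{rs}\neq0$. Policy iteration from an initial guess $v^0\in\mathbb R^M$ is the following procedure: for $\ell=1,2,\dots$, pick $P^\ell\in\mathcal P$ with $-A(P^\ell)v^{\ell-1}+b(P^\ell)=\sup_{P\in\mathcal P}\{-A(P)v^{\ell-1}+b(P)\}$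 and let $v^\ell$ be the solution of $A(P^\ell)v^\ell=b(P^\ell)$. Then $A(P)$ is nonsingular for every $P\in\mathcal P$, so that policy iteration is well defined from every $v^0$. For every $P\in\mathcal P$ and every initial state, the series $\sum_{n\ge0} U(X^n,P)\prod_{m=0}^{n-1}D(X^m,P)$ converges absolutely almost surely and its sum is integrable. The suprema $$v_i=\sup_{P\in\mathcal P}\mathbb E\Big[\sum_{n=0}^\infty U(X^n,P)\prod_{m=0}^{n-1}D(X^m,P)\,\Big|\,X^0=i\Big],\qquad 1\le i\le M,$$ are finite, and for every initial guess $v^0\in\mathbb R^M$ and every choice of the maximizing policies $P^\ell$, the policy iterates $v^\ell$ converge to $v=(v_1,\dots,v_M)$ as $\ell\to\infty$. -/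

import Mathlib

open MeasureTheory ProbabilityTheory Filter Topology

noncomputable section

/-! ### Bellman problems on `ℝ^M` and policy iteration

`ℝ^M` is `Fin M → ℝ` with the element-wise order, so that `IsLUB` of a set of vectors is the
element-wise supremum. -/

/-- The vector `-A(P) x + b(P)`. -/
def bellmanResidual {M : ℕ} {Pol : Type} (A : Pol → Matrix (Fin M) (Fin M) ℝ) (b : Pol → Fin M → ℝ)
    (x : Fin M → ℝ) (P : Pol) : Fin M → ℝ :=
  -(Matrix.mulVec (A P) x) + b P

/-- The policy `P` attains `sup_{P'} { -A(P') x + b(P') }`. -/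
def AttainsSup {M : ℕ} {Pol : Type} (A : Pol → Matrix (Fin M) (Fin M) ℝ) (b : Pol → Fin M → ℝ)
    (x : Fin M → ℝ) (P : Pol) : Prop :=
  IsLUB (Set.range (bellmanResidual A b x)) (bellmanResidual A b x P)

/-- `P ↦ A(P)⁻¹` is bounded on the set of policies `P` with `A(P)` nonsingular. -/
def InverseBounded {M : ℕ} {Pol : Type} (A : Pol → Matrix (Fin M) (Fin M) ℝ) : Prop :=
  ∃ C : ℝ, ∀ P, IsUnit (A P) → ∀ i j, |(A P)⁻¹ i j| ≤ C

/-- `A` and `b` are bounded, and for each `x` the supremum of `-A(P) x + b(P)` is attained. -/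
def BoundedAndArgsup {M : ℕ} {Pol : Type} (A : Pol → Matrix (Fin M) (Fin M) ℝ)
    (b : Pol → Fin M → ℝ) : Prop :=
  ((∃ C : ℝ, ∀ P i j, |A P i j| ≤ C) ∧ (∃ C : ℝ, ∀ P i, |b P i| ≤ C)) ∧
    ∀ x : Fin M → ℝ, ∃ P, AttainsSup A b x P

/-- `P 1, P 2, …` and `v 0, v 1, …` are the policies and iterates of a run of policy iteration
started at `v⁰` (`P 0` is not used): `P (ℓ+1)` attains the supremum at `v ℓ`, and `v (ℓ+1)` solves
the linear system `A(P (ℓ+1)) v (ℓ+1) = b(P (ℓ+1))`. -/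
def IsPolicyIteration {M : ℕ} {Pol : Type} (A : Pol → Matrix (Fin M) (Fin M) ℝ)
    (b : Pol → Fin M → ℝ) (v₀ : Fin M → ℝ) (P : ℕ → Pol) (v : ℕ → Fin M → ℝ) : Prop :=
  v 0 = v₀ ∧ ∀ l, AttainsSup A b (v l) (P (l + 1)) ∧
    Matrix.mulVec (A (P (l + 1))) (v (l + 1)) = b (P (l + 1))

/-! ### The controlled Markov chain -/

/-- Data of an infinite-horizon controlled Markov chain on `M` states in which some states have
vanishing discount. -/
structure ControlledChain (M : ℕ) where
  /-- transition laws available at a discounted state -/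
  W : Fin M → Set (Fin M → ℝ)
  /-- transition laws available at a state with vanishing discount -/
  Z : Fin M → Set (Fin M → ℝ)
  /-- admissible values of the switch `ψ_i`; `1` makes the discount vanish -/
  D : Fin M → Set (Fin 2)
  W_nonempty : ∀ i, (W i).Nonempty
  Z_nonempty : ∀ i, (Z i).Nonempty
  D_nonempty : ∀ i, (D i).Nonempty
  W_prob : ∀ i, W i ⊆ stdSimplex ℝ (Fin M)
  Z_prob : ∀ i, Z i ⊆ stdSimplex ℝ (Fin M)
  /-- rewards at discounted states -/
  c : (i : Fin M) → W i → ℝ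
  /-- rewards at states with vanishing discount -/
  k : (i : Fin M) → Z i → ℝ
  /-- discount factor -/
  ρ : ℝ
  ρ_pos : 0 < ρ

namespace ControlledChain

variable {M : ℕ} (𝒞 : ControlledChain M)

/-- The control set `𝒫 = ∏ i, W_i × Z_i × D_i`. -/
abbrev Policy : Type := (i : Fin M) → 𝒞.W i × 𝒞.Z i × 𝒞.D i

variable {𝒞}

/-- The row `w_i` of the policy. -/
def w (P : 𝒞.Policy) (i : Fin M) : 𝒞.W i := (P i).1

/-- The row `z_i` of the policy. -/
def z (P : 𝒞.Policy) (i : Fin M) : 𝒞.Z i := (P i).2.1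

/-- The switch `ψ_i ∈ {0, 1}` of the policy. -/
def ψ (P : 𝒞.Policy) (i : Fin M) : Fin 2 := (P i).2.2

/-- `Ψ = diag(ψ)`. -/
def Psi (P : 𝒞.Policy) : Matrix (Fin M) (Fin M) ℝ :=
  Matrix.diagonal fun i => if ψ P i = 0 then 0 else 1

/-- `[L(w)]_{ij} = w_{ij} / (1 + ρ)`. -/
def L (P : 𝒞.Policy) : Matrix (Fin M) (Fin M) ℝ :=
  Matrix.of fun i j => (w P i : Fin M → ℝ) j / (1 + 𝒞.ρ)

/-- `[B(z)]_{ij} = z_{ij}`. -/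
def B (P : 𝒞.Policy) : Matrix (Fin M) (Fin M) ℝ :=
  Matrix.of fun i j => (z P i : Fin M → ℝ) j

/-- `A(P) = (I - Ψ)(I - L(w)) + δ Ψ (I - B(z))`. -/
def A (δ : ℝ) (P : 𝒞.Policy) : Matrix (Fin M) (Fin M) ℝ :=
  (1 - Psi P) * (1 - L P) + δ • (Psi P * (1 - B P))

/-- `b(P) = (I - Ψ) c(w) + δ Ψ k(z)`. -/
def b (δ : ℝ) (P : 𝒞.Policy) : Fin M → ℝ :=
  Matrix.mulVec (1 - Psi P) (fun i => 𝒞.c i (w P i)) +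
    δ • Matrix.mulVec (Psi P) (fun i => 𝒞.k i (z P i))

variable (𝒞) in
/-- For each policy and each state `i` with `ψ_i = 1` there is a path in the directed graph of
`B(z)` from `i` to some state `j` with `ψ_j = 0`. -/
def PathToDiscount : Prop :=
  ∀ (P : 𝒞.Policy) (i : Fin M), ψ P i = 1 →
    ∃ j, ψ P j = 0 ∧ Relation.ReflTransGen (fun r s => B P r s ≠ 0) i j

/-- The law of the next state when the chain is at `i`: `w_i` if `ψ_i = 0`, `z_i` if `ψ_i = 1`. -/
def transProb (P : 𝒞.Policy) (i j : Fin M) : ℝ :=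
  if ψ P i = 0 then (w P i : Fin M → ℝ) j else (z P i : Fin M → ℝ) j

lemma transProb_nonneg (P : 𝒞.Policy) (i j : Fin M) : 0 ≤ transProb P i j := by
  unfold transProb
  split_ifs
  · exact (𝒞.W_prob i (w P i).2).1 j
  · exact (𝒞.Z_prob i (z P i).2).1 j

lemma sum_transProb (P : 𝒞.Policy) (i : Fin M) : ∑ j, transProb P i j = 1 := by
  unfold transProb
  split_ifs
  · exact (𝒞.W_prob i (w P i).2).2
  · exact (𝒞.Z_prob i (z P i).2).2

/-- The one-step transition kernel of the chain under the policy `P`. -/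
def step (P : 𝒞.Policy) : Kernel (Fin M) (Fin M) where
  toFun i := ∑ j, ENNReal.ofReal (transProb P i j) • Measure.dirac j
  measurable' := measurable_of_finite _

instance (P : 𝒞.Policy) : IsMarkovKernel (step P) where
  isProbabilityMeasure i := ⟨by
    have h : step P i = ∑ j, ENNReal.ofReal (transProb P i j) • Measure.dirac j := rfl
    rw [h]
    simp only [Measure.coe_finsetSum, Finset.sum_apply, Measure.smul_apply, measure_univ,
      smul_eq_mul, mul_one]
    rw [← ENNReal.ofReal_sum_of_nonneg fun j _ => transProb_nonneg P i j, sum_transProb,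
      ENNReal.ofReal_one]⟩

/-- The next state given the history `X⁰, …, Xⁿ`: a `step` from the current state `Xⁿ`. -/
def histStep (P : 𝒞.Policy) (n : ℕ) : Kernel (Finset.Iic n → Fin M) (Fin M) :=
  (step P).comap (fun h => h ⟨n, Finset.mem_Iic.2 le_rfl⟩) (measurable_pi_apply _)

instance (P : 𝒞.Policy) (n : ℕ) : IsMarkovKernel (histStep P n) := by
  unfold histStep
  infer_instance

/-- The law, on the space of trajectories `(Xⁿ)_{n ≥ 0}`, of the Markov chain with transition
kernel `step P` started from `X⁰ = i`. -/
def chainLaw (P : 𝒞.Policy) (i : Fin M) : Measure (ℕ → Fin M) :=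
  Kernel.traj (X := fun _ => Fin M) (histStep P) 0 (fun _ => i)

/-- The one-step reward `U(i, P)`. -/
def U (P : 𝒞.Policy) (i : Fin M) : ℝ :=
  if ψ P i = 0 then 𝒞.c i (w P i) else 𝒞.k i (z P i)

/-- The one-step discount `D(i, P)`. -/
def disc (P : 𝒞.Policy) (i : Fin M) : ℝ :=
  if ψ P i = 0 then 1 / (1 + 𝒞.ρ) else 1

/-- The discounted reward collected at time `n` along the trajectory `X`. -/
def rewardAt (P : 𝒞.Policy) (X : ℕ → Fin M) (n : ℕ) : ℝ :=
  U P (X n) * ∏ m ∈ Finset.range n, disc P (X m)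

/-- The total discounted reward along the trajectory `X`. -/
def totalReward (P : 𝒞.Policy) (X : ℕ → Fin M) : ℝ := ∑' n, rewardAt P X n

/-- The total discounted reward from `X⁰ = i` under `P` has a well-defined expectation: the series
converges almost surely, absolutely, to an integrable random variable. -/
def RewardWellDefined (P : 𝒞.Policy) (i : Fin M) : Prop :=
  (∀ᵐ X ∂chainLaw P i, Summable (rewardAt P X)) ∧ Integrable (totalReward P) (chainLaw P i)

/-- `𝔼[∑ₙ U(Xⁿ, P) ∏_{m<n} D(Xᵐ, P) | X⁰ = i]`. -/
def expectedReward (P : 𝒞.Policy) (i : Fin M) : ℝ := ∫ X, totalReward P X ∂chainLaw P i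

variable (𝒞) in
/-- `v` is the value function: `v_i` is the (finite) supremum over all policies of the expected
total discounted reward from the initial state `i`. -/
def IsValueFunction (v : Fin M → ℝ) : Prop :=
  ∀ i, IsLUB (Set.range fun P : 𝒞.Policy => expectedReward P i) (v i)

end ControlledChain

end

/-! Row `i` of `A(P) x - b(P)` is a positive multiple (1 or `δ`) of `x - U - T x`, where `T = discOp
P` is the discounted transition operator. Hence `A(P) x = b(P)` is the fixed-point equation `x = U +
T x`, whose solution is the Neumann series `∑ Tⁿ U`, and `Tⁿ U` is the expected discounted reward at
time `n`.

Everything rests on a minimum principle (`nonneg_of_discOp_le`): `T x ≤ x` forces `0 ≤ x`, because a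
negative minimum would spread along the path of H2 to a discounted state, where it is impossible.
This gives comparison and nonsingularity for `A(P)`, and convergence of the Neumann series.

Every iterate after the initial guess is therefore the expected reward of a policy. Maximality and
comparison make these iterates increase; H0 and the bound on `b` keep them bounded. As `A` is
bounded, the maximal residual tends to 0, so the limit dominates every policy's reward; being a
supremum of such rewards, it is the value function. -/

namespace ControlledChain

variable {M : ℕ} {𝒞 : ControlledChain M}

/-! ### The discounted transition operator -/

/-- The discounted transition operator: `[T f]_i = D(i, P) ∑ j, p_{ij} f_j`. -/
noncomputable def discOp (P : 𝒞.Policy) (f : Fin M → ℝ) (i : Fin M) : ℝ :=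
  disc P i * ∑ j, transProb P i j * f j

lemma disc_nonneg (P : 𝒞.Policy) (i : Fin M) : 0 ≤ disc P i := by
  have := 𝒞.ρ_pos
  unfold disc
  split_ifs <;> positivity

lemma discOp_mono (P : 𝒞.Policy) {f g : Fin M → ℝ} (h : f ≤ g) : discOp P f ≤ discOp P g :=
  fun i => mul_le_mul_of_nonneg_left (Finset.sum_le_sum fun j _ =>
    mul_le_mul_of_nonneg_left (h j) (transProb_nonneg P i j)) (disc_nonneg P i)

lemma discOp_zero (P : 𝒞.Policy) : discOp P 0 = 0 := by
  ext i
  simp [discOp]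

lemma discOp_add (P : 𝒞.Policy) (f g : Fin M → ℝ) :
    discOp P (f + g) = discOp P f + discOp P g := by
  ext i
  simp only [discOp, Pi.add_apply, mul_add, Finset.sum_add_distrib]

lemma discOp_sub (P : 𝒞.Policy) (f g : Fin M → ℝ) :
    discOp P (f - g) = discOp P f - discOp P g := by
  ext i
  simp only [discOp, Pi.sub_apply, mul_sub, Finset.sum_sub_distrib]

lemma discOp_sum (P : 𝒞.Policy) {ι : Type*} (s : Finset ι) (f : ι → Fin M → ℝ) :
    discOp P (∑ n ∈ s, f n) = ∑ n ∈ s, discOp P (f n) := by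
  classical
  induction s using Finset.induction_on with
  | empty => simp [discOp_zero]
  | insert a s ha ih => rw [Finset.sum_insert ha, Finset.sum_insert ha, discOp_add, ih]

lemma continuous_discOp (P : 𝒞.Policy) : Continuous (discOp P) := by
  unfold discOp
  fun_prop

lemma iterate_discOp_nonneg (P : 𝒞.Policy) {f : Fin M → ℝ} (hf : 0 ≤ f) (n : ℕ) :
    0 ≤ (discOp P)^[n] f := by
  induction n with
  | zero => exact hf
  | succ n ih =>
    rw [Function.iterate_succ_apply']
    exact (discOp_zero P).symm.le.trans (discOp_mono P ih)

lemma A_mulVec_apply (δ : ℝ) (P : 𝒞.Policy) (x : Fin M → ℝ) (i : Fin M) :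
    (A δ P).mulVec x i = (if ψ P i = 0 then 1 else δ) * (x i - discOp P x i) := by
  simp only [A, Psi, Matrix.add_mulVec, Matrix.smul_mulVec, ← Matrix.mulVec_mulVec,
    Matrix.sub_mulVec, Matrix.one_mulVec, Pi.add_apply, Pi.sub_apply, Pi.smul_apply, smul_eq_mul,
    Matrix.mulVec_diagonal]
  by_cases h : ψ P i = 0
  · simp only [h, L, Matrix.mulVec, dotProduct, discOp, disc, transProb, if_true, Matrix.of_apply,
      Finset.mul_sum]
    simp [div_eq_inv_mul, mul_assoc]
  · simp [h, B, Matrix.mulVec, dotProduct, discOp, disc, transProb]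

lemma b_apply (δ : ℝ) (P : 𝒞.Policy) (i : Fin M) :
    b δ P i = (if ψ P i = 0 then 1 else δ) * U P i := by
  by_cases h : ψ P i = 0 <;>
    simp [b, Psi, U, h, Matrix.sub_mulVec, Matrix.mulVec_diagonal]

lemma A_mulVec_nonneg_iff {δ : ℝ} (hδ : 0 < δ) (P : 𝒞.Policy) (x : Fin M → ℝ) :
    0 ≤ (A δ P).mulVec x ↔ discOp P x ≤ x := by
  refine forall_congr' fun i => ?_
  rw [A_mulVec_apply, Pi.zero_apply, mul_nonneg_iff_of_pos_left (by split_ifs <;> positivity),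
    sub_nonneg]

lemma A_mulVec_eq_b_iff {δ : ℝ} (hδ : 0 < δ) (P : 𝒞.Policy) (x : Fin M → ℝ) :
    (A δ P).mulVec x = b δ P ↔ x = U P + discOp P x := by
  rw [funext_iff, funext_iff]
  refine forall_congr' fun i => ?_
  have hc : (if ψ P i = 0 then 1 else δ) ≠ 0 := by split_ifs <;> positivity
  rw [A_mulVec_apply, b_apply, mul_right_inj' hc, sub_eq_iff_eq_add, Pi.add_apply]

/-! ### The minimum principle -/

/-- A supersolution of the homogeneous equation is nonnegative. -/
lemma nonneg_of_discOp_le (H2 : 𝒞.PathToDiscount) (P : 𝒞.Policy) {x : Fin M → ℝ}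
    (hx : discOp P x ≤ x) : 0 ≤ x := by
  by_contra hneg
  obtain ⟨k, hk⟩ : ∃ k, x k < 0 := by
    simpa [Pi.le_def] using hneg
  have : Nonempty (Fin M) := ⟨k⟩
  obtain ⟨i₀, hi₀⟩ := Finite.exists_min x
  have hm : x i₀ < 0 := (hi₀ k).trans_lt hk
  have hmean : ∀ i, x i₀ ≤ ∑ j, transProb P i j * x j := fun i => by
    calc x i₀ = ∑ j, transProb P i j * x i₀ := by
          rw [← Finset.sum_mul, sum_transProb, one_mul]
      _ ≤ _ := Finset.sum_le_sum fun j _ =>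
          mul_le_mul_of_nonneg_left (hi₀ j) (transProb_nonneg P i j)
  -- At a discounted minimizer, `x i₀ ≤ (1 + ρ) x i₀`, which fails for a negative minimum.
  have hψ : ∀ i, x i = x i₀ → ψ P i = 1 := fun i hi => by
    by_contra h1
    have h0 : ψ P i = 0 := by omega
    have h := hx i
    have hρ := 𝒞.ρ_pos
    simp only [discOp, disc, h0, if_true] at h
    rw [one_div, inv_mul_le_iff₀ (by positivity)] at h
    nlinarith [hmean i]
  -- Without discount, the mean of `x` over the successors is at most the minimum, so every
  -- successor of positive probability is a minimizer.
  have hstep : ∀ i j, x i = x i₀ → B P i j ≠ 0 → x j = x i₀ := fun i j hi hij => by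
    have h1 := hψ i hi
    have h := hx i
    simp only [discOp, disc, h1, one_ne_zero, if_false, one_mul] at h
    have hzero : ∑ l, transProb P i l * (x l - x i₀) = 0 := by
      simp only [mul_sub, Finset.sum_sub_distrib, ← Finset.sum_mul, sum_transProb, one_mul]
      linarith [hmean i]
    have := (Finset.sum_eq_zero_iff_of_nonneg fun l _ =>
      mul_nonneg (transProb_nonneg P i l) (sub_nonneg.2 (hi₀ l))).1 hzero j (Finset.mem_univ j)
    have hp : transProb P i j = B P i j := by simp [transProb, B, h1]
    rw [hp] at this
    exact sub_eq_zero.1 ((mul_eq_zero.1 this).resolve_left hij)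
  obtain ⟨j, hj, hpath⟩ := H2 P i₀ (hψ i₀ rfl)
  have hxj : x j = x i₀ := by
    -- Kept, `hj` would burden the induction hypothesis with `ψ = 0` at intermediate states.
    clear hj
    induction hpath with
    | refl => rfl
    | tail _ hbc ih => exact hstep _ _ ih hbc
  exact absurd (hψ j hxj) (by simp [hj])

/-- Minimum principle applied to `y - x`; this comparison drives both nonsingularity and the
convergence proof. -/
lemma le_of_A_mulVec_le {δ : ℝ} (hδ : 0 < δ) (H2 : 𝒞.PathToDiscount) (P : 𝒞.Policy)
    {x y : Fin M → ℝ} (h : (A δ P).mulVec x ≤ (A δ P).mulVec y) : x ≤ y := by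
  have : 0 ≤ (A δ P).mulVec (y - x) := by rwa [Matrix.mulVec_sub, sub_nonneg]
  exact sub_nonneg.1 (nonneg_of_discOp_le H2 P ((A_mulVec_nonneg_iff hδ P _).1 this))

lemma isUnit_A {δ : ℝ} (hδ : 0 < δ) (H2 : 𝒞.PathToDiscount) (P : 𝒞.Policy) :
    IsUnit (A δ P) :=
  Matrix.mulVec_injective_iff_isUnit.1 fun _ _ hxy =>
    le_antisymm (le_of_A_mulVec_le hδ H2 P hxy.le) (le_of_A_mulVec_le hδ H2 P hxy.ge)

lemma exists_eq_add_discOp (H2 : 𝒞.PathToDiscount) (P : 𝒞.Policy) (f : Fin M → ℝ) :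
    ∃ h, h = f + discOp P h := by
  -- For `δ = 1` all row factors are 1, so the matrix is exactly `I - T`.
  obtain ⟨h, hh⟩ := Matrix.mulVec_surjective_iff_isUnit.2 (isUnit_A one_pos H2 P) f
  refine ⟨h, funext fun i => ?_⟩
  have := congrFun hh i
  rw [A_mulVec_apply] at this
  simp only [ite_self, one_mul] at this
  rw [Pi.add_apply]
  linarith

lemma eq_of_eq_add_discOp (H2 : 𝒞.PathToDiscount) (P : 𝒞.Policy) {f x y : Fin M → ℝ}
    (hx : x = f + discOp P x) (hy : y = f + discOp P y) : x = y := by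
  have key : ∀ {x y : Fin M → ℝ}, x = f + discOp P x → y = f + discOp P y → x ≤ y := by
    intro x y hx hy
    refine sub_nonneg.1 (nonneg_of_discOp_le H2 P (le_of_eq ?_))
    rw [discOp_sub]
    conv_rhs => rw [hx, hy]
    abel
  exact le_antisymm (key hx hy) (key hy hx)

/-! ### Neumann series -/

/-- The solution `h` of `h = f + T h` bounds all partial sums, inductively: `S_{N+1} = f + T S_N ≤ f
+ T h = h`. -/
lemma summable_iterate_discOp (H2 : 𝒞.PathToDiscount) (P : 𝒞.Policy) {f : Fin M → ℝ}
    (hf : 0 ≤ f) : Summable fun n => (discOp P)^[n] f := by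
  obtain ⟨h, hh⟩ := exists_eq_add_discOp H2 P f
  have h0 : 0 ≤ h := nonneg_of_discOp_le H2 P (by
    conv_rhs => rw [hh]
    exact le_add_of_nonneg_left hf)
  have hsum : ∀ N, ∑ n ∈ Finset.range N, (discOp P)^[n] f ≤ h := fun N => by
    induction N with
    | zero => simpa using h0
    | succ N ih =>
      rw [Finset.sum_range_succ', hh, Function.iterate_zero, id, add_comm]
      refine add_le_add le_rfl ?_
      simp only [Function.iterate_succ_apply']
      rw [← discOp_sum]
      exact discOp_mono P ih
  refine Pi.summable.2 fun i => ?_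
  refine summable_of_sum_range_le (c := h i) (fun n => iterate_discOp_nonneg P hf n i) fun N => ?_
  simpa using hsum N i

/-- The Neumann series of the discounted transition operator. -/
lemma hasSum_iterate_discOp (H2 : 𝒞.PathToDiscount) (P : 𝒞.Policy) {f u : Fin M → ℝ}
    (hs : Summable fun n => (discOp P)^[n] f) (hu : u = f + discOp P u) :
    HasSum (fun n => (discOp P)^[n] f) u := by
  obtain ⟨s, hs⟩ := hs
  have hs' := hs.tendsto_sum_nat
  have hlim := ((continuous_discOp P).tendsto s).comp hs' |>.const_add f
  have hs'' := (tendsto_add_atTop_iff_nat 1).2 hs'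
  have : s = f + discOp P s := by
    refine tendsto_nhds_unique hs'' (hlim.congr fun N => ?_)
    rw [Finset.sum_range_succ', Function.comp_apply, discOp_sum, add_comm]
    simp only [Function.iterate_succ_apply', Function.iterate_zero, id]
  rwa [eq_of_eq_add_discOp H2 P hu this]

/-! ### Expectations along the chain -/

lemma integral_step (P : 𝒞.Policy) (i : Fin M) (f : Fin M → ℝ) :
    ∫ j, f j ∂step P i = ∑ j, transProb P i j * f j := by
  have h : step P i = ∑ j, ENNReal.ofReal (transProb P i j) • Measure.dirac j := rfl
  rw [h, integral_finsetSum_measure fun j _ => (Integrable.of_finite (f := f)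
    (μ := Measure.dirac j)).smul_measure ENNReal.ofReal_ne_top]
  refine Finset.sum_congr rfl fun j _ => ?_
  rw [integral_smul_measure, integral_dirac, ENNReal.toReal_ofReal (transProb_nonneg P i j),
    smul_eq_mul]

instance (P : 𝒞.Policy) (i : Fin M) : IsProbabilityMeasure (chainLaw P i) := by
  unfold chainLaw
  infer_instance

/-- The law of the history up to time `n`, together with the state at time `n + 1`. -/
lemma integral_chainLaw_succ (P : 𝒞.Policy) (i : Fin M) (n : ℕ)
    (F : (Finset.Iic n → Fin M) → ℝ) (f : Fin M → ℝ) :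
    ∫ X, F (Preorder.frestrictLe n X) * f (X (n + 1)) ∂chainLaw P i =
      ∫ X, F (Preorder.frestrictLe n X) * ∑ j, transProb P (X n) j * f j ∂chainLaw P i := by
  have hmap := Kernel.partialTraj_compProd_eq_map_traj (X := fun _ => Fin M) (κ := histStep P)
    (Nat.zero_le n) (x₀ := fun _ => i)
  have h1 : ∫ X, F (Preorder.frestrictLe n X) * f (X (n + 1)) ∂chainLaw P i =
      ∫ p, F p.1 * f p.2 ∂(chainLaw P i).map
        (fun X => ((Preorder.frestrictLe n X : Finset.Iic n → Fin M), X (n + 1))) := by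
    rw [integral_map (by fun_prop) (measurable_of_finite _).aestronglyMeasurable]
  -- The joint law of history and next state is the history law composed with `histStep`, so Fubini
  -- integrates the next state out first.
  rw [h1, chainLaw, ← hmap, Measure.integral_compProd .of_finite,
    ← Kernel.traj_map_frestrictLe_apply,
    integral_map (by fun_prop) (measurable_of_finite _).aestronglyMeasurable]
  refine integral_congr_ae (ae_of_all _ fun X => ?_)
  simp only [integral_const_mul]
  congr 1
  exact integral_step P _ f

lemma measurable_mul_prod_disc (P : 𝒞.Policy) (f : Fin M → ℝ) (n : ℕ) :
    Measurable fun X : ℕ → Fin M => f (X n) * ∏ m ∈ Finset.range n, disc P (X m) :=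
  ((measurable_of_finite f).comp (measurable_pi_apply n)).mul
    (Finset.measurable_prod _ fun m _ =>
      (measurable_of_finite (disc P)).comp (measurable_pi_apply m))

lemma disc_le_one (P : 𝒞.Policy) (i : Fin M) : disc P i ≤ 1 := by
  have := 𝒞.ρ_pos
  unfold disc
  split_ifs
  · rw [div_le_one (by positivity)]
    linarith
  · exact le_rfl

lemma integrable_mul_prod_disc (P : 𝒞.Policy) (i : Fin M) (f : Fin M → ℝ) (n : ℕ) :
    Integrable (fun X => f (X n) * ∏ m ∈ Finset.range n, disc P (X m)) (chainLaw P i) := by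
  refine Integrable.of_bound (measurable_mul_prod_disc P f n).aestronglyMeasurable
    (∑ j, |f j|) (ae_of_all _ fun X => ?_)
  have hprod : |∏ m ∈ Finset.range n, disc P (X m)| ≤ 1 := by
    rw [abs_of_nonneg (Finset.prod_nonneg fun m _ => disc_nonneg P _)]
    exact Finset.prod_le_one (fun m _ => disc_nonneg P _) fun m _ => disc_le_one P _
  rw [Real.norm_eq_abs, abs_mul]
  calc |f (X n)| * |∏ m ∈ Finset.range n, disc P (X m)| ≤ |f (X n)| :=
        mul_le_of_le_one_right (abs_nonneg _) hprod
    _ ≤ _ := Finset.single_le_sum (f := fun j => |f j|) (fun j _ => abs_nonneg _)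
        (Finset.mem_univ (X n))

/-- The expectation of a discounted reward is an iterate of the discounted transition operator. -/
lemma integral_mul_prod_disc (P : 𝒞.Policy) (i : Fin M) (n : ℕ) (f : Fin M → ℝ) :
    ∫ X, f (X n) * ∏ m ∈ Finset.range n, disc P (X m) ∂chainLaw P i = (discOp P)^[n] f i := by
  induction n generalizing f with
  | zero =>
    have hmap := Kernel.traj_map_frestrictLe_apply (X := fun _ => Fin M) (κ := histStep P) 0 0
      (fun _ => i)
    have h1 : ∫ X, f (X 0) ∂chainLaw P i =
        ∫ h, f (h ⟨0, Finset.mem_Iic.2 le_rfl⟩) ∂(chainLaw P i).map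
          (Preorder.frestrictLe (π := fun _ => Fin M) 0) := by
      rw [integral_map (by fun_prop) (measurable_of_finite _).aestronglyMeasurable]
      rfl
    simp only [Finset.range_zero, Finset.prod_empty, mul_one, Function.iterate_zero, id]
    rw [h1, chainLaw, hmap, Kernel.partialTraj_self, Kernel.id_apply, integral_dirac]
  | succ n ih =>
    -- The last transition is peeled off, replacing `f` by `T f`; hence the induction over all `f`.
    rw [Function.iterate_succ_apply, ← ih]
    have := integral_chainLaw_succ P i n (fun h => ∏ m : Finset.Iic n, disc P (h m)) f
    have hF : ∀ X : ℕ → Fin M, ∏ m : Finset.Iic n, disc P (Preorder.frestrictLe n X m) =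
        disc P (X n) * ∏ m ∈ Finset.range n, disc P (X m) := fun X => by
      rw [mul_comm, ← Finset.prod_range_succ]
      have : Finset.range (n + 1) = Finset.Iic n := by
        ext
        simp
      rw [this]
      exact Finset.prod_coe_sort (Finset.Iic n) fun m => disc P (X m)
    simp only [hF] at this
    simp only [Finset.prod_range_succ, discOp]
    convert this using 3 <;> ring

end ControlledChain

/-! ### Series of integrable functions -/

/-- A series of integrable functions whose `L¹` norms are summable converges absolutely almost
everywhere. -/
lemma ae_summable_of_summable_integral_norm {α : Type*} [MeasurableSpace α] {μ : Measure α}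
    {F : ℕ → α → ℝ} (hF : ∀ n, Integrable (F n) μ) (hs : Summable fun n => ∫ a, ‖F n a‖ ∂μ) :
    ∫⁻ a, ∑' n, ‖F n a‖ₑ ∂μ ≠ ⊤ ∧ ∀ᵐ a ∂μ, Summable fun n => F n a := by
  have hfin : ∫⁻ a, ∑' n, ‖F n a‖ₑ ∂μ ≠ ⊤ := by
    rw [lintegral_tsum fun n => (hF n).1.enorm]
    have : ∀ n, ∫⁻ a, ‖F n a‖ₑ ∂μ = ENNReal.ofReal (∫ a, ‖F n a‖ ∂μ) := fun n => by
      rw [ofReal_integral_norm_eq_lintegral_enorm (hF n)]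
    simp only [this]
    exact hs.tsum_ofReal_ne_top
  refine ⟨hfin, ?_⟩
  filter_upwards [ae_lt_top' (AEMeasurable.tsum fun n => (hF n).1.enorm) hfin] with a ha
  exact .of_enorm ha.ne

lemma integrable_tsum_of_summable_integral_norm {α : Type*} [MeasurableSpace α] {μ : Measure α}
    {F : ℕ → α → ℝ} (hF : ∀ n, Integrable (F n) μ) (hs : Summable fun n => ∫ a, ‖F n a‖ ∂μ) :
    Integrable (fun a => ∑' n, F n a) μ := by
  obtain ⟨hfin, hsum⟩ := ae_summable_of_summable_integral_norm hF hs
  refine ⟨?_, ?_⟩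
  · refine aestronglyMeasurable_of_tendsto_ae atTop
      (f := fun N a => ∑ n ∈ Finset.range N, F n a) (fun N => ?_) ?_
    · exact Finset.aestronglyMeasurable_fun_sum _ fun n _ => (hF n).1
    · filter_upwards [hsum] with a ha
      exact ha.hasSum.tendsto_sum_nat
  · exact (lintegral_mono fun a => enorm_tsum_le_tsum_enorm).trans_lt hfin.lt_top

/-! ### The expected total reward -/

namespace ControlledChain

variable {M : ℕ} {𝒞 : ControlledChain M}

lemma integral_norm_rewardAt (P : 𝒞.Policy) (i : Fin M) (n : ℕ) :
    ∫ X, ‖rewardAt P X n‖ ∂chainLaw P i = (discOp P)^[n] |U P| i := by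
  rw [← integral_mul_prod_disc]
  refine integral_congr_ae (ae_of_all _ fun X => ?_)
  simp only [rewardAt, Real.norm_eq_abs, abs_mul, Pi.abs_apply]
  rw [abs_of_nonneg (Finset.prod_nonneg fun m _ => disc_nonneg P _)]

lemma summable_integral_norm_rewardAt (H2 : 𝒞.PathToDiscount) (P : 𝒞.Policy) (i : Fin M) :
    Summable fun n => ∫ X, ‖rewardAt P X n‖ ∂chainLaw P i := by
  simp only [integral_norm_rewardAt]
  exact Pi.summable.1 (summable_iterate_discOp H2 P (abs_nonneg (U P))) i

lemma rewardWellDefined (H2 : 𝒞.PathToDiscount) (P : 𝒞.Policy) (i : Fin M) :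
    RewardWellDefined P i :=
  ⟨(ae_summable_of_summable_integral_norm (fun n => integrable_mul_prod_disc P i (U P) n)
      (summable_integral_norm_rewardAt H2 P i)).2,
    integrable_tsum_of_summable_integral_norm (fun n => integrable_mul_prod_disc P i (U P) n)
      (summable_integral_norm_rewardAt H2 P i)⟩

/-- The vector of expected total rewards is the solution of the linear system of the policy. -/
lemma eq_expectedReward {δ : ℝ} (hδ : 0 < δ) (H2 : 𝒞.PathToDiscount) (P : 𝒞.Policy)
    {u : Fin M → ℝ} (hu : (A δ P).mulVec u = b δ P) : u = expectedReward P := by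
  rw [A_mulVec_eq_b_iff hδ] at hu
  have hsum : ∀ i, HasSum (fun n => (discOp P)^[n] (U P) i) (expectedReward P i) := fun i => by
    simp only [← integral_mul_prod_disc P i]
    exact hasSum_integral_of_summable_integral_norm
      (fun n => integrable_mul_prod_disc P i (U P) n) (summable_integral_norm_rewardAt H2 P i)
  exact (hasSum_iterate_discOp H2 P ⟨_, Pi.hasSum.2 hsum⟩ hu).unique (Pi.hasSum.2 hsum)

/-! ### Policy iteration -/

lemma A_mulVec_expectedReward {δ : ℝ} (hδ : 0 < δ) (H2 : 𝒞.PathToDiscount) (P : 𝒞.Policy) :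
    (A δ P).mulVec (expectedReward P) = b δ P := by
  obtain ⟨u, hu⟩ := Matrix.mulVec_surjective_iff_isUnit.2 (isUnit_A hδ H2 P) (b δ P)
  rwa [← eq_expectedReward hδ H2 P hu]

/-- Puts the residual in the form to which comparison applies. -/
lemma bellmanResidual_eq {δ : ℝ} (hδ : 0 < δ) (H2 : 𝒞.PathToDiscount) (P : 𝒞.Policy)
    (x : Fin M → ℝ) :
    bellmanResidual (A δ) (b δ) x P = (A δ P).mulVec (expectedReward P - x) := by
  rw [bellmanResidual, Matrix.mulVec_sub, A_mulVec_expectedReward hδ H2, neg_add_eq_sub]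

lemma exists_isPolicyIteration {δ : ℝ} (hδ : 0 < δ) (H2 : 𝒞.PathToDiscount)
    (hmax : ∀ x, ∃ P : 𝒞.Policy, AttainsSup (A δ) (b δ) x P) (v₀ : Fin M → ℝ) :
    ∃ (P : ℕ → 𝒞.Policy) (u : ℕ → Fin M → ℝ), IsPolicyIteration (A δ) (b δ) v₀ P u := by
  choose Q hQ using hmax
  let u : ℕ → Fin M → ℝ := fun n => (fun x => expectedReward (Q x))^[n] v₀
  -- The truncated subtraction matters only at `l = 0`, whose policy is never used.
  refine ⟨fun l => Q (u (l - 1)), u, rfl, fun l => ⟨hQ _, ?_⟩⟩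
  have : u (l + 1) = expectedReward (Q (u l)) := Function.iterate_succ_apply' _ _ _
  rw [this]
  exact A_mulVec_expectedReward hδ H2 _

lemma exists_abs_expectedReward_le {δ : ℝ} (hδ : 0 < δ) (H2 : 𝒞.PathToDiscount)
    (H0 : InverseBounded (A (𝒞 := 𝒞) δ)) (hb : ∃ C : ℝ, ∀ (P : 𝒞.Policy) i, |b δ P i| ≤ C) :
    ∃ C : ℝ, ∀ (P : 𝒞.Policy) i, |expectedReward P i| ≤ C := by
  obtain ⟨C, hC⟩ := H0
  obtain ⟨K, hK⟩ := hb
  refine ⟨∑ _j : Fin M, C * K, fun P i => ?_⟩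
  have hu := isUnit_A hδ H2 P
  have : expectedReward P = ((A δ P)⁻¹).mulVec (b δ P) := by
    rw [← A_mulVec_expectedReward hδ H2, Matrix.mulVec_mulVec,
      Matrix.nonsing_inv_mul _ ((Matrix.isUnit_iff_isUnit_det _).1 hu), Matrix.one_mulVec]
  rw [this]
  rw [Matrix.mulVec, dotProduct]
  refine (Finset.abs_sum_le_sum_abs _ _).trans (Finset.sum_le_sum fun j _ => ?_)
  rw [abs_mul]
  exact mul_le_mul (hC P hu i j) (hK P j) (abs_nonneg _) ((abs_nonneg _).trans (hC P hu i j))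

/-- Policy iterates converge to the value function. -/
lemma exists_isValueFunction_tendsto {δ : ℝ} (hδ : 0 < δ) (H2 : 𝒞.PathToDiscount)
    (H0 : InverseBounded (A (𝒞 := 𝒞) δ)) (H1 : BoundedAndArgsup (A (𝒞 := 𝒞) δ) (b δ))
    {v₀ : Fin M → ℝ} {P : ℕ → 𝒞.Policy} {u : ℕ → Fin M → ℝ}
    (hPI : IsPolicyIteration (A δ) (b δ) v₀ P u) :
    ∃ v, 𝒞.IsValueFunction v ∧ Tendsto u atTop (𝓝 v) := by
  obtain ⟨⟨⟨CA, hCA⟩, hb⟩, -⟩ := H1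
  obtain ⟨C, hC⟩ := exists_abs_expectedReward_le hδ H2 H0 hb
  have hu : ∀ l, u (l + 1) = expectedReward (P (l + 1)) := fun l =>
    eq_expectedReward hδ H2 _ (hPI.2 l).2
  have hres : ∀ l Q, (A δ Q).mulVec (expectedReward Q - u l) ≤
      (A δ (P (l + 1))).mulVec (u (l + 1) - u l) := fun l Q => by
    have := (hPI.2 l).1.1 ⟨Q, rfl⟩
    rwa [bellmanResidual_eq hδ H2, bellmanResidual_eq hδ H2, ← hu] at this
  -- The shift drops the arbitrary initial guess. The policy that produced `u (l + 1)` has zero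
  -- residual there, so the maximal residual is nonnegative.
  have hmono : Monotone fun l => u (l + 1) := monotone_nat_of_le_succ fun l => by
    refine sub_nonneg.1 (le_of_A_mulVec_le hδ H2 (P (l + 1 + 1)) ?_)
    have := hres (l + 1) (P (l + 1))
    rwa [← hu, sub_self, Matrix.mulVec_zero, ← Matrix.mulVec_zero (A δ (P (l + 1 + 1)))] at this
  have hbdd : ∀ i, BddAbove (Set.range fun l => u (l + 1) i) := fun i => ⟨C, by
    rintro _ ⟨l, rfl⟩
    simp only [hu]
    exact (le_abs_self _).trans (hC _ i)⟩
  set v : Fin M → ℝ := fun i => ⨆ l, u (l + 1) i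
  have hlim' : Tendsto (fun l => u (l + 1)) atTop (𝓝 v) := tendsto_pi_nhds.2 fun i =>
    tendsto_atTop_ciSup (fun a c hac => hmono hac i) (hbdd i)
  have hlim : Tendsto u atTop (𝓝 v) := (tendsto_add_atTop_iff_nat 1).1 hlim'
  refine ⟨v, fun i => ⟨?_, fun y hy => ?_⟩, hlim⟩
  · rintro _ ⟨Q, rfl⟩
    refine le_of_A_mulVec_le hδ H2 Q (sub_nonpos.1 ?_) i
    rw [← Matrix.mulVec_sub]
    intro k
    have hdiff : Tendsto (fun l => u (l + 1) - u l) atTop (𝓝 0) := by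
      simpa using hlim'.sub hlim
    -- The matrix varies with `l`, so the bound `CA`, uniform over policies, is needed.
    have hright : Tendsto (fun l => (A δ (P (l + 1))).mulVec (u (l + 1) - u l) k) atTop (𝓝 0) := by
      have hsum : Tendsto (fun l => ∑ j, CA * |(u (l + 1) - u l) j|) atTop (𝓝 0) := by
        have : Tendsto (fun l => ∑ j, CA * |(u (l + 1) - u l) j|) atTop
            (𝓝 (∑ j : Fin M, CA * |(0 : Fin M → ℝ) j|)) :=
          tendsto_finsetSum _ fun j _ => ((tendsto_pi_nhds.1 hdiff j).abs).const_mul CA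
        simpa using this
      refine squeeze_zero_norm (fun l => ?_) hsum
      rw [Matrix.mulVec, dotProduct, Real.norm_eq_abs]
      refine (Finset.abs_sum_le_sum_abs _ _).trans (Finset.sum_le_sum fun j _ => ?_)
      rw [abs_mul]
      exact mul_le_mul_of_nonneg_right (hCA _ _ _) (abs_nonneg _)
    have hcont : Continuous fun x : Fin M → ℝ => (A δ Q).mulVec (expectedReward Q - x) k := by
      fun_prop
    exact le_of_tendsto_of_tendsto' ((hcont.tendsto v).comp hlim) hright fun l => hres l Q k
  · refine ciSup_le fun l => ?_
    rw [hu]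
    exact hy ⟨_, rfl⟩

lemma IsValueFunction.unique {v w : Fin M → ℝ} (hv : 𝒞.IsValueFunction v)
    (hw : 𝒞.IsValueFunction w) : v = w :=
  funext fun i => (hv i).unique (hw i)

end ControlledChain

theorem mainTheorem5 (M : ℕ) (𝒞 : ControlledChain M) (δ : ℝ) (hδ : 0 < δ)
    (H0 : InverseBounded (ControlledChain.A (𝒞 := 𝒞) δ))
    (H1 : BoundedAndArgsup (ControlledChain.A (𝒞 := 𝒞) δ) (ControlledChain.b δ))
    (H2 : 𝒞.PathToDiscount) :
    (∀ (P : 𝒞.Policy) (i : Fin M), ControlledChain.RewardWellDefined P i) ∧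
    (∀ P : 𝒞.Policy, IsUnit (ControlledChain.A δ P)) ∧
    ∃ v : Fin M → ℝ, 𝒞.IsValueFunction v ∧
      ∀ v₀ : Fin M → ℝ,
        (∃ (P : ℕ → 𝒞.Policy) (u : ℕ → Fin M → ℝ),
          IsPolicyIteration (ControlledChain.A δ) (ControlledChain.b δ) v₀ P u) ∧
        ∀ (P : ℕ → 𝒞.Policy) (u : ℕ → Fin M → ℝ),
          IsPolicyIteration (ControlledChain.A δ) (ControlledChain.b δ) v₀ P u →
            Tendsto u atTop (𝓝 v) := by
  refine ⟨fun P i => ControlledChain.rewardWellDefined H2 P i,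
    fun P => ControlledChain.isUnit_A hδ H2 P, ?_⟩
  have hex := ControlledChain.exists_isPolicyIteration hδ H2 H1.2
  -- A run from 0 supplies `v`; uniqueness of the value function identifies the limits of all other
  -- runs with it.
  obtain ⟨P₀, u₀, h₀⟩ := hex 0
  obtain ⟨v, hv, -⟩ := ControlledChain.exists_isValueFunction_tendsto hδ H2 H0 H1 h₀
  refine ⟨v, hv, fun v₀ => ⟨hex v₀, fun P u hPI => ?_⟩⟩
  obtain ⟨v', hv', hlim⟩ := ControlledChain.exists_isValueFunction_tendsto hδ H2 H0 H1 hPI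
  rwa [hv.unique hv']
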